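/- For a Borel measure $\nu$ on $\mathbb{C}$ with compact support let $I(\nu)=\iint\log|z-w|\,d\nu(z)\,d\nu(w)\in[-\infty,\infty)$ (with $\log 0=-\infty$). A set is polar if $I(\nu)=-\infty$ for every finite Borel measure $\nu\neq 0$ whose support is a compact subset of it, and $\mathrm{Cap}(E)=\sup_\nu e^{I(\nu)}$, the supremum being over all Borel probability measures $\nu$ with compact support contained in $E$. For a non-polar compact set $K\subset\mathbb{C}$ let $\mu_K$ be its equilibrium measure, i.e. the unique Borel probability measure on $K$ maximizing $I$, and let $\Omega_K$ be the connected component of $\overline{\mathbb{C}}\setminus K$ containing $\infty$. For a Borel probability measure $\mu$ on $\mathbb{C}$ with infinite compact support let $P_n(\cdot;\mu)$ be the monic polynomial of degree $n$ with the smallest norm in $L^2(\mathbb{C};\mu)$ among all monic polynomials of degree $n$, and put $$W_n(\mu)=\frac{\|P_n(\cdot;\mu)\|_{L^2(\mathbb{C};\mu)}}{\mathrm{Cap}(\mathrm{supp}(\mu))^n}.$$ **Theorem.** Let $K$ be a non-polar compact subset of $\mathbb{C}$ and let $\mu$ be a Borel probability measure on $\mathbb{C}$ supported on a compact set containing $\partial\Omega_K$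 (that is, $\mathrm{supp}(\mu)\subseteq L$ for some compact $L\supseteq\partial\Omega_K$). Let $\mu_s$ denote the singular part of $\mu$ with respect to $\mu_K$, and let $h$ be a non-negative measurable function on $\partial\Omega_K$ such that * $d\mu=h\,d\mu_K+d\mu_s$, * $M:=\int\log h\,d\mu_K>-\infty$, * $\mathrm{Cap}(\mathrm{supp}(\mu))=\mathrm{Cap}(\mathrm{supp}(\mu_K))$. Then $$\inf_{n\in\mathbb{N}}\,(W_n(\mu))^2\geq e^M.$$ -/

import Mathlib

open MeasureTheory
open scoped NNReal ENNReal

noncomputable section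

namespace LogPotential

/-- The integral of an extended-real-valued function, `∫ f⁺ dμ - ∫ f⁻ dμ`, with values in `[-∞, ∞]`
(the value is `-∞` if `∫ f⁻ dμ = ∞`, by the convention `∞ - ∞ = -∞` of `EReal`). -/
def extIntegral {α : Type*} [MeasurableSpace α] (μ : Measure α) (f : α → EReal) : EReal :=
  ((∫⁻ x, (f x).toENNReal ∂μ : ℝ≥0∞) : EReal) - ((∫⁻ x, (-f x).toENNReal ∂μ : ℝ≥0∞) : EReal)

/-- The logarithmic energy `I(ν) = ∬ log |z - w| dν(z) dν(w)`, where `log 0 = -∞`. -/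
def logEnergy (ν : Measure ℂ) : EReal :=
  extIntegral (ν.prod ν) fun p => ENNReal.log ‖p.1 - p.2‖ₑ

/-- `E` is polar: `I(ν) = -∞` for every finite Borel measure `ν ≠ 0` whose support is a compact
subset of `E`. -/
def IsPolar (E : Set ℂ) : Prop :=
  ∀ ν : Measure ℂ, IsFiniteMeasure ν → ν ≠ 0 → IsCompact ν.support → ν.support ⊆ E →
    logEnergy ν = ⊥

/-- The logarithmic capacity `Cap E = sup_ν exp I(ν)`, the supremum being over all Borel probability
measures `ν` whose support is a compact subset of `E`; here `exp (-∞) = 0`. -/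
def logCapacity (E : Set ℂ) : ℝ≥0∞ :=
  ⨆ (ν : Measure ℂ) (_ : IsProbabilityMeasure ν) (_ : IsCompact ν.support) (_ : ν.support ⊆ E),
    EReal.exp (logEnergy ν)

/-- `ν` is an equilibrium measure of the compact set `K`: a Borel probability measure on `K` of
maximal logarithmic energy. -/
structure IsEquilibriumMeasure (K : Set ℂ) (ν : Measure ℂ) : Prop where
  isProbabilityMeasure : IsProbabilityMeasure ν
  support_subset : ν.support ⊆ K
  logEnergy_le : ∀ ν' : Measure ℂ, IsProbabilityMeasure ν' → ν'.support ⊆ K →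
    logEnergy ν' ≤ logEnergy ν

open Classical in
/-- The equilibrium measure `μ_K` of a compact set `K` (it exists and is unique if `K` is compact and
non-polar; the value `0` is used where there is none). -/
def equilibriumMeasure (K : Set ℂ) : Measure ℂ :=
  if hK : ∃ ν, IsEquilibriumMeasure K ν then hK.choose else 0

/-- `Ω_K`: the connected component of `∞` in the complement of `K` in the Riemann sphere. -/
def outerDomain (K : Set ℂ) : Set (OnePoint ℂ) :=
  connectedComponentIn ((fun z : ℂ => (z : OnePoint ℂ)) '' K)ᶜ OnePoint.infty

/-- The boundary `∂Ω_K`, taken in the Riemann sphere; for compact `K` it does not contain `∞`, and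
it is regarded here as a subset of `ℂ`. -/
def outerBoundary (K : Set ℂ) : Set ℂ :=
  (fun z : ℂ => (z : OnePoint ℂ)) ⁻¹' frontier (outerDomain K)

/-- The norm `‖P‖` of a polynomial in `L²(ℂ; μ)`. -/
def polyNorm (μ : Measure ℂ) (P : Polynomial ℂ) : ℝ≥0∞ :=
  eLpNorm (fun z => P.eval z) 2 μ

/-- `P` is a monic polynomial of degree `n` whose norm in `L²(ℂ; μ)` is minimal among all monic
polynomials of degree `n`. -/
structure IsMonicMinimizer (μ : Measure ℂ) (n : ℕ) (P : Polynomial ℂ) : Prop where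
  monic : P.Monic
  natDegree_eq : P.natDegree = n
  polyNorm_le : ∀ Q : Polynomial ℂ, Q.Monic → Q.natDegree = n → polyNorm μ P ≤ polyNorm μ Q

open Classical in
/-- The `n`-th monic orthogonal polynomial `P_n(·; μ)` (it exists for every finite measure with
compact support, and is unique if the support is infinite; the value `0` is used where there is
none). -/
def monicOrthogonalPolynomial (μ : Measure ℂ) (n : ℕ) : Polynomial ℂ :=
  if hP : ∃ P, IsMonicMinimizer μ n P then hP.choose else 0

/-- The Widom factor `W_n(μ) = ‖P_n(·; μ)‖ / Cap(supp μ)ⁿ`. -/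
def widomFactor (μ : Measure ℂ) (n : ℕ) : ℝ≥0∞ :=
  polyNorm μ (monicOrthogonalPolynomial μ n) / logCapacity μ.support ^ n

/-- The Szegő integral `∫ log h dμ_K`, where `log 0 = -∞`. -/
def szegoIntegral (K : Set ℂ) (h : ℂ → ℝ≥0) : EReal :=
  extIntegral (equilibriumMeasure K) fun z => ENNReal.log (h z : ℝ≥0∞)

end LogPotential

end

/-! Write `ν` for the equilibrium measure, `U` for its logarithmic potential and `I` for its energy.
For a monic `P` of degree `n` with zeros `a_j`, dropping the singular part and applying Jensen's
inequality to `exp` gives `‖P‖² ≥ ∫ |P|² h dν ≥ exp (∫ log h dν + 2 ∑ U(a_j))`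
(`ofReal_exp_le_lintegral_sq_mul`). Since `U ≥ I` at every point of the plane and `exp I` is the
capacity of `supp ν`, hence of `supp μ`, the right side is at least `exp M · Cap(supp μ)^(2n)`.

The main work is Frostman's bound `U ≥ I` without an exceptional set, because zeros may lie
anywhere. Perturbing `ν` gives it `ν`-a.e. (`ae_le_logPotential`), truncated kernels carry it to
every point of `supp ν`, and a minimum principle carries it to the rest of the plane
(`le_logPotential_of_le_on`).

The equilibrium measure and the orthogonal polynomials are defined by choice with a default value,
so their existence is proved too (`exists_isEquilibriumMeasure`, `exists_isMonicMinimizer`);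
uniqueness plays no role. -/

noncomputable section

namespace LogPotential

open Filter Topology

/-! ### Integrals of extended-real functions. -/

section ExtIntegral

variable {α : Type*} [MeasurableSpace α] {μ : Measure α}

lemma toENNReal_log_le (x : ℝ≥0∞) : (ENNReal.log x).toENNReal ≤ x := by
  rcases eq_or_ne x 0 with rfl | h0
  · simp
  rcases eq_or_ne x ∞ with rfl | h1
  · simp
  rw [ENNReal.log_pos_real h0 h1, EReal.real_coe_toENNReal]
  exact ENNReal.ofReal_le_of_le_toReal (Real.log_le_self ENNReal.toReal_nonneg)

lemma extIntegral_eq_integral {f : α → EReal} {g : α → ℝ} (hg : Integrable g μ)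
    (hfg : ∀ᵐ x ∂μ, f x = g x) : extIntegral μ f = ((∫ x, g x ∂μ : ℝ) : EReal) := by
  have h1 : ∫⁻ x, (f x).toENNReal ∂μ = ∫⁻ x, ENNReal.ofReal (g x) ∂μ :=
    lintegral_congr_ae (hfg.mono fun x hx => by simp [hx])
  have h2 : ∫⁻ x, (-f x).toENNReal ∂μ = ∫⁻ x, ENNReal.ofReal (-g x) ∂μ :=
    lintegral_congr_ae (hfg.mono fun x hx => by
      simp only [hx, ← EReal.coe_neg, EReal.real_coe_toENNReal])
  have f1 : ∫⁻ x, ENNReal.ofReal (g x) ∂μ ≠ ∞ := hg.lintegral_lt_top.ne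
  have f2 : ∫⁻ x, ENNReal.ofReal (-g x) ∂μ ≠ ∞ := hg.neg.lintegral_lt_top.ne
  rw [extIntegral, h1, h2, integral_eq_lintegral_pos_part_sub_lintegral_neg_part hg,
    EReal.coe_sub, EReal.coe_ennreal_toReal f1, EReal.coe_ennreal_toReal f2]

lemma lintegral_neg_ne_top_of_extIntegral_ne_bot {f : α → EReal} (h : extIntegral μ f ≠ ⊥) :
    ∫⁻ x, (-f x).toENNReal ∂μ ≠ ∞ := by
  intro h'
  apply h
  rw [extIntegral, h']
  simp [sub_eq_add_neg]

/-- If `∫ g dμ < ∞` and `∫ log g dμ > -∞`, then `log g` is a real-valued integrable function. -/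
lemma integrable_log_of_extIntegral_ne_bot {g : α → ℝ≥0∞} (hg : AEMeasurable g μ)
    (hfin : ∫⁻ x, g x ∂μ ≠ ∞) (h : extIntegral μ (fun x => ENNReal.log (g x)) ≠ ⊥) :
    (∀ᵐ x ∂μ, g x ≠ 0 ∧ g x ≠ ∞) ∧ Integrable (fun x => Real.log (g x).toReal) μ ∧
      extIntegral μ (fun x => ENNReal.log (g x)) = ((∫ x, Real.log (g x).toReal ∂μ : ℝ) : EReal) := by
  have hneg := lintegral_neg_ne_top_of_extIntegral_ne_bot h
  have hmeas : AEMeasurable (fun x => (-ENNReal.log (g x)).toENNReal) μ := by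
    have : Measurable fun y : ℝ≥0∞ => (-ENNReal.log y).toENNReal := by fun_prop
    exact this.comp_aemeasurable hg
  have hae : ∀ᵐ x ∂μ, g x ≠ 0 ∧ g x ≠ ∞ := by
    filter_upwards [ae_lt_top' hmeas hneg, ae_lt_top' hg hfin] with x h1 h2
    refine ⟨fun h0 => ?_, h2.ne⟩
    simp [h0] at h1
  have hlog : ∀ᵐ x ∂μ, ENNReal.log (g x) = (Real.log (g x).toReal : ℝ) :=
    hae.mono fun x hx => ENNReal.log_pos_real hx.1 hx.2
  have hint : Integrable (fun x => Real.log (g x).toReal) μ := by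
    refine ⟨(Real.measurable_log.comp_aemeasurable hg.ennreal_toReal).aestronglyMeasurable, ?_⟩
    have hle : ∀ᵐ x ∂μ, ‖Real.log (g x).toReal‖ₑ ≤ g x + (-ENNReal.log (g x)).toENNReal := by
      filter_upwards [hlog] with x hx
      have h1 := toENNReal_log_le (g x)
      rw [hx, EReal.real_coe_toENNReal] at h1
      rw [hx, ← EReal.coe_neg, EReal.real_coe_toENNReal]
      rw [← ofReal_norm, Real.norm_eq_abs]
      rcases le_total 0 (Real.log (g x).toReal) with h | h
      · rw [abs_of_nonneg h]; exact h1.trans le_self_add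
      · rw [abs_of_nonpos h]; exact le_add_self
    refine (lintegral_mono_ae hle).trans_lt ?_
    rw [lintegral_add_left' hg]
    exact ENNReal.add_lt_top.2 ⟨hfin.lt_top, hneg.lt_top⟩
  exact ⟨hae, hint, extIntegral_eq_integral hint hlog⟩

end ExtIntegral

/-! ### Existence of an equilibrium measure by weak compactness. -/

section Existence

/-- The kernel `max (R - log max (|z - w|, 1 / (m + 1)), 0)`. -/
def truncKernel (R : ℝ) (m : ℕ) (p : ℂ × ℂ) : ℝ≥0 :=
  Real.toNNReal (R - Real.log (max ‖p.1 - p.2‖ (1 / (m + 1))))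

lemma continuous_log_max_norm_sub (m : ℕ) :
    Continuous fun p : ℂ × ℂ => Real.log (max ‖p.1 - p.2‖ (1 / (m + 1))) := by
  refine Continuous.log (by fun_prop) fun p => ?_
  have : (0 : ℝ) < 1 / (m + 1) := by positivity
  exact (this.trans_le (le_max_right _ _)).ne'

lemma continuous_truncKernel (R : ℝ) (m : ℕ) : Continuous (truncKernel R m) :=
  continuous_real_toNNReal.comp (continuous_const.sub (continuous_log_max_norm_sub m))

lemma truncKernel_le (R : ℝ) (m : ℕ) (p : ℂ × ℂ) :
    truncKernel R m p ≤ Real.toNNReal (R - Real.log (1 / (m + 1))) := by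
  refine Real.toNNReal_le_toNNReal (sub_le_sub_left ?_ _)
  exact Real.log_le_log (by positivity) (le_max_right _ _)

lemma monotone_truncKernel (R : ℝ) (p : ℂ × ℂ) : Monotone fun m => truncKernel R m p := by
  intro m n hmn
  refine Real.toNNReal_le_toNNReal (sub_le_sub_left ?_ _)
  refine Real.log_le_log (lt_max_of_lt_right (by positivity)) (max_le_max le_rfl ?_)
  gcongr

/-- The energy of `ν` with respect to the nonnegative kernel `max (R - log |z - w|, 0)`. -/
def posEnergy (R : ℝ) (ν : Measure ℂ) : ℝ≥0∞ :=
  ⨆ m, ∫⁻ p, truncKernel R m p ∂(ν.prod ν)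

/-- Each truncated kernel is bounded and continuous and `ν ↦ ν × ν` is weakly continuous, so this is
a supremum of continuous functions. -/
lemma lowerSemicontinuous_posEnergy (R : ℝ) :
    LowerSemicontinuous fun ν : ProbabilityMeasure ℂ => posEnergy R (ν : Measure ℂ) := by
  refine lowerSemicontinuous_iSup fun m => Continuous.lowerSemicontinuous ?_
  let F : BoundedContinuousFunction (ℂ × ℂ) ℝ≥0 :=
    BoundedContinuousFunction.mkOfBound ⟨truncKernel R m, continuous_truncKernel R m⟩
      (Real.toNNReal (R - Real.log (1 / (m + 1)))) fun p q => by
        simp only [ContinuousMap.coe_mk, NNReal.dist_eq]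
        have h1 : (truncKernel R m p : ℝ) ≤ _ := NNReal.coe_le_coe.2 (truncKernel_le R m p)
        have h2 : (truncKernel R m q : ℝ) ≤ _ := NNReal.coe_le_coe.2 (truncKernel_le R m q)
        have h3 := (truncKernel R m p).coe_nonneg
        have h4 := (truncKernel R m q).coe_nonneg
        rw [abs_le]
        constructor <;> linarith
  have hc : Continuous fun ν : ProbabilityMeasure ℂ => ν.prod ν :=
    ProbabilityMeasure.continuous_prod.comp (continuous_id.prodMk continuous_id)
  refine continuous_iff_continuousAt.2 fun ν => ?_
  exact (ProbabilityMeasure.tendsto_iff_forall_lintegral_tendsto.1 (hc.tendsto ν)) F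

/-- The truncations increase to `R - log |z - w|`. Writing this with sums of positive parts avoids
subtraction, and on the diagonal both sides are `∞`. -/
lemma iSup_truncKernel_add {R : ℝ} (hR : 0 ≤ R) {p : ℂ × ℂ} (hp : ‖p.1 - p.2‖ ≤ Real.exp R) :
    (⨆ m, (truncKernel R m p : ℝ≥0∞)) + (ENNReal.log ‖p.1 - p.2‖ₑ).toENNReal =
      ENNReal.ofReal R + (-ENNReal.log ‖p.1 - p.2‖ₑ).toENNReal := by
  rcases eq_or_ne (p.1 - p.2) 0 with h0 | h0
  · simp only [truncKernel, h0, norm_zero, enorm_zero, ENNReal.log_zero, EReal.toENNReal_bot,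
      add_zero, EReal.neg_bot, EReal.toENNReal_top, add_top]
    refine ENNReal.eq_top_of_forall_nnreal_le fun r => ?_
    -- On the diagonal the kernel is `R + log (m + 1)`, which is unbounded in `m`.
    obtain ⟨m, hm⟩ := exists_nat_ge (Real.exp r)
    refine le_iSup_of_le m ?_
    rw [ENNReal.coe_le_coe]
    apply NNReal.le_toNNReal_of_coe_le
    rw [max_eq_right (by positivity), one_div, Real.log_inv]
    have : (r : ℝ) ≤ Real.log (m + 1) := by
      rw [Real.le_log_iff_exp_le (by positivity)]; linarith
    linarith
  · have hpos : 0 < ‖p.1 - p.2‖ := norm_pos_iff.2 h0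
    have hlog : ENNReal.log ‖p.1 - p.2‖ₑ = ((Real.log ‖p.1 - p.2‖ : ℝ) : EReal) := by
      rw [← ofReal_norm, ENNReal.log_ofReal_of_pos hpos]
    have hle : Real.log ‖p.1 - p.2‖ ≤ R := by
      rwa [Real.log_le_iff_le_exp hpos]
    have hsup : (⨆ m, (truncKernel R m p : ℝ≥0∞)) =
        ENNReal.ofReal (R - Real.log ‖p.1 - p.2‖) := by
      apply le_antisymm
      · refine iSup_le fun m => ENNReal.ofReal_le_ofReal (sub_le_sub_left ?_ _)
        exact Real.log_le_log hpos (le_max_left _ _)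
      · obtain ⟨m, hm⟩ := exists_nat_one_div_lt hpos
        refine le_iSup_of_le m ?_
        rw [truncKernel, max_eq_left hm.le]
        rfl
    rw [hsup, hlog, ← EReal.coe_neg, EReal.real_coe_toENNReal, EReal.real_coe_toENNReal]
    rcases le_total 0 (Real.log ‖p.1 - p.2‖) with h | h
    · rw [ENNReal.ofReal_of_nonpos (neg_nonpos.2 h), ← ENNReal.ofReal_add (by linarith) h]
      simp
    · rw [ENNReal.ofReal_of_nonpos h, ← ENNReal.ofReal_add hR (by linarith)]
      simp [sub_eq_add_neg]

/-- Turns maximizing the energy into minimizing a lower semicontinuous functional. Bounded distances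
make the integral of `log⁺` finite, so only the negative part can be infinite. -/
lemma logEnergy_eq_sub_posEnergy {R : ℝ} (hR : 0 ≤ R) {ν : Measure ℂ} [IsProbabilityMeasure ν]
    (hν : ∀ᵐ p ∂ν.prod ν, ‖p.1 - p.2‖ ≤ Real.exp R) :
    logEnergy ν = (R : EReal) - (posEnergy R ν : EReal) := by
  have hJ : posEnergy R ν = ∫⁻ p, ⨆ m, (truncKernel R m p : ℝ≥0∞) ∂(ν.prod ν) := by
    rw [posEnergy, lintegral_iSup]
    · exact fun m => (continuous_truncKernel R m).measurable.coe_nnreal_ennreal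
    · exact fun m n hmn p => ENNReal.coe_le_coe.2 (monotone_truncKernel R p hmn)
  have hm : Measurable fun p : ℂ × ℂ => ENNReal.log ‖p.1 - p.2‖ₑ := by fun_prop
  have hadd : posEnergy R ν + ∫⁻ p, (ENNReal.log ‖p.1 - p.2‖ₑ).toENNReal ∂(ν.prod ν) =
      ENNReal.ofReal R + ∫⁻ p, (-ENNReal.log ‖p.1 - p.2‖ₑ).toENNReal ∂(ν.prod ν) := by
    rw [hJ, ← lintegral_add_right _ (by fun_prop),
      lintegral_congr_ae (hν.mono fun p hp => iSup_truncKernel_add hR hp),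
      lintegral_add_left measurable_const]
    simp
  have hP : ∫⁻ p, (ENNReal.log ‖p.1 - p.2‖ₑ).toENNReal ∂(ν.prod ν) ≠ ∞ := by
    have : ∫⁻ p, (ENNReal.log ‖p.1 - p.2‖ₑ).toENNReal ∂(ν.prod ν) ≤
        ∫⁻ _, ENNReal.ofReal (Real.exp R) ∂(ν.prod ν) := by
      refine lintegral_mono_ae (hν.mono fun p hp => (toENNReal_log_le _).trans ?_)
      rw [← ofReal_norm]
      exact ENNReal.ofReal_le_ofReal hp
    refine (this.trans_lt ?_).ne
    simp
  rw [logEnergy, extIntegral]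
  generalize ∫⁻ p, (ENNReal.log ‖p.1 - p.2‖ₑ).toENNReal ∂(ν.prod ν) = P at *
  generalize ∫⁻ p, (-ENNReal.log ‖p.1 - p.2‖ₑ).toENNReal ∂(ν.prod ν) = N at *
  generalize posEnergy R ν = J at *
  rcases eq_or_ne N ∞ with rfl | hN
  · have : J = ∞ := by
      by_contra hJ'
      have : J + P ≠ ∞ := ENNReal.add_ne_top.2 ⟨hJ', hP⟩
      simp [hadd] at this
    simp [this, sub_eq_add_neg]
  · have hJ' : J ≠ ∞ := by
      rintro rfl
      have : ENNReal.ofReal R + N ≠ ∞ := ENNReal.add_ne_top.2 ⟨ENNReal.ofReal_ne_top, hN⟩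
      simp [← hadd] at this
    have := congrArg ENNReal.toReal hadd
    rw [ENNReal.toReal_add hJ' hP, ENNReal.toReal_add ENNReal.ofReal_ne_top hN,
      ENNReal.toReal_ofReal hR] at this
    rw [← EReal.coe_ennreal_toReal hP, ← EReal.coe_ennreal_toReal hN,
      ← EReal.coe_ennreal_toReal hJ', ← EReal.coe_sub, ← EReal.coe_sub, EReal.coe_eq_coe_iff]
    linarith

lemma support_subset_iff_measure_compl {K : Set ℂ} (hK : IsClosed K) {ν : Measure ℂ} :
    ν.support ⊆ K ↔ ν Kᶜ = 0 :=
  ⟨fun h => measure_mono_null (Set.compl_subset_compl.2 h) Measure.measure_compl_support,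
    fun h => Measure.support_subset_of_isClosed hK (mem_ae_iff.2 h)⟩

lemma ae_prod_mem {K : Set ℂ} {ν : Measure ℂ} [SFinite ν] (hν : ∀ᵐ z ∂ν, z ∈ K) :
    ∀ᵐ p ∂ν.prod ν, p.1 ∈ K ∧ p.2 ∈ K :=
  (Measure.quasiMeasurePreserving_fst.ae hν).and (Measure.quasiMeasurePreserving_snd.ae hν)

lemma exists_norm_sub_le_exp {K : Set ℂ} (hK : IsCompact K) :
    ∃ R : ℝ, 0 ≤ R ∧ ∀ z ∈ K, ∀ w ∈ K, ‖z - w‖ ≤ Real.exp R := by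
  obtain ⟨C, hC⟩ := hK.isBounded.exists_norm_le
  refine ⟨2 * |C|, by positivity, fun z hz w hw => (norm_sub_le z w).trans ?_⟩
  have h1 := hC z hz
  have h2 := hC w hw
  have h3 := le_abs_self C
  have h4 := Real.add_one_le_exp (2 * |C|)
  linarith

theorem exists_isEquilibriumMeasure {K : Set ℂ} (hK : IsCompact K) (hne : K.Nonempty) :
    ∃ ν, IsEquilibriumMeasure K ν := by
  obtain ⟨R, hR, hRK⟩ := exists_norm_sub_le_exp hK
  -- The idle quantifier matches the tightness criterion used for compactness, taken with the
  -- constant sequence `K` and bound `0`.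
  let A : Set (ProbabilityMeasure ℂ) := {ν | ∀ _ : ℕ, ν Kᶜ ≤ 0}
  have hA : IsCompact A :=
    isCompact_setOfPred_probabilityMeasure_mass_eq_compl_isCompact_le (u := fun _ => 0)
      tendsto_const_nhds (fun _ => hK) (Or.inl inferInstance)
  have hmemA (ν : ProbabilityMeasure ℂ) : ν ∈ A ↔ (ν : Measure ℂ) Kᶜ = 0 := by
    simp [A, ProbabilityMeasure.null_iff_toMeasure_null]
  obtain ⟨z, hz⟩ := hne
  have hAne : A.Nonempty := by
    refine ⟨⟨Measure.dirac z, inferInstance⟩, (hmemA _).2 ?_⟩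
    simp [Measure.dirac_apply' _ hK.measurableSet.compl, hz]
  have hen (ν : Measure ℂ) [IsProbabilityMeasure ν] (hν : ν Kᶜ = 0) :
      logEnergy ν = (R : EReal) - (posEnergy R ν : EReal) :=
    logEnergy_eq_sub_posEnergy hR ((ae_prod_mem (mem_ae_iff.2 hν)).mono
      fun p hp => hRK _ hp.1 _ hp.2)
  obtain ⟨ν, hνA, hν⟩ :=
    LowerSemicontinuousOn.exists_isMinOn hAne hA
      ((lowerSemicontinuous_posEnergy R).lowerSemicontinuousOn A)
  refine ⟨ν, ν.2, (support_subset_iff_measure_compl hK.isClosed).2 ((hmemA ν).1 hνA),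
    fun ν' hν' hs => ?_⟩
  have h' := (support_subset_iff_measure_compl hK.isClosed).1 hs
  rw [hen ν' h', hen ν ((hmemA ν).1 hνA)]
  have := hν (a := ⟨ν', hν'⟩) ((hmemA _).2 h')
  exact EReal.sub_le_sub le_rfl (EReal.coe_ennreal_le_coe_ennreal_iff.2 this)

end Existence

/-! ### Potentials and measures of finite energy. -/

/-- The logarithmic potential `∫ log |z - w| dν(w)`. -/
def logPotential (ν : Measure ℂ) (z : ℂ) : ℝ :=
  ∫ w, Real.log ‖z - w‖ ∂ν

/-- The potential `∫ log max (|z - w|, 1 / (m + 1)) dν(w)`. -/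
def truncPotential (ν : Measure ℂ) (m : ℕ) (z : ℂ) : ℝ :=
  ∫ w, Real.log (max ‖z - w‖ (1 / (m + 1))) ∂ν

lemma lintegral_enorm_sub_ne_top {K : Set ℂ} (hK : IsCompact K) {ν : Measure ℂ}
    [IsFiniteMeasure ν] (hν : ∀ᵐ z ∂ν, z ∈ K) :
    ∫⁻ p, ‖p.1 - p.2‖ₑ ∂(ν.prod ν) ≠ ∞ := by
  obtain ⟨R, -, hR⟩ := exists_norm_sub_le_exp hK
  have : ∫⁻ p, ‖p.1 - p.2‖ₑ ∂(ν.prod ν) ≤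
      ∫⁻ _, ENNReal.ofReal (Real.exp R) ∂(ν.prod ν) := by
    refine lintegral_mono_ae ((ae_prod_mem hν).mono fun p hp => ?_)
    rw [← ofReal_norm]
    exact ENNReal.ofReal_le_ofReal (hR _ hp.1 _ hp.2)
  refine (this.trans_lt ?_).ne
  rw [lintegral_const]
  exact ENNReal.mul_lt_top ENNReal.ofReal_lt_top (measure_lt_top _ _)

lemma logEnergy_eq_integral {ν : Measure ℂ}
    (hint : Integrable (fun p : ℂ × ℂ => Real.log ‖p.1 - p.2‖) (ν.prod ν))
    (hdiag : ∀ᵐ p ∂ν.prod ν, p.1 ≠ p.2) :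
    logEnergy ν = ((∫ p, Real.log ‖p.1 - p.2‖ ∂(ν.prod ν) : ℝ) : EReal) := by
  refine extIntegral_eq_integral hint (hdiag.mono fun p hp => ?_)
  rw [← ofReal_norm, ENNReal.log_ofReal_of_pos (norm_pos_iff.2 (sub_ne_zero.2 hp))]

/-- Compactness controls `log⁺` and finite energy controls `log⁻`. The null diagonal is recorded
because `Real.log 0 = 0` would hide the value `-∞` there. -/
lemma integrable_log_of_logEnergy_ne_bot {K : Set ℂ} (hK : IsCompact K) {ν : Measure ℂ}
    [IsFiniteMeasure ν] (hν : ∀ᵐ z ∂ν, z ∈ K) (h : logEnergy ν ≠ ⊥) :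
    Integrable (fun p : ℂ × ℂ => Real.log ‖p.1 - p.2‖) (ν.prod ν) ∧
      ∀ᵐ p ∂ν.prod ν, p.1 ≠ p.2 := by
  obtain ⟨h1, h2, -⟩ := integrable_log_of_extIntegral_ne_bot
    (g := fun p : ℂ × ℂ => ‖p.1 - p.2‖ₑ) (by fun_prop) (lintegral_enorm_sub_ne_top hK hν) h
  simp only [toReal_enorm] at h2
  refine ⟨h2, h1.mono fun p hp hp' => hp.1 ?_⟩
  simp [hp']

/-- An atom at `z` would give the diagonal point `(z, z)` mass `ν {z} ^ 2`. -/
lemma ae_ne_of_ae_prod_ne {ν : Measure ℂ} [SFinite ν]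
    (hdiag : ∀ᵐ p ∂ν.prod ν, p.1 ≠ p.2) (z : ℂ) : ∀ᵐ w ∂ν, w ≠ z := by
  have h : (ν.prod ν) ({z} ×ˢ {z}) = 0 := by
    refine measure_mono_null ?_ (ae_iff.1 hdiag)
    rintro ⟨a, b⟩ ⟨ha, hb⟩
    simp_all
  rw [Measure.prod_prod] at h
  simpa [ae_iff] using h

/-! ### First variation of the energy. -/

section Variation

variable {K : Set ℂ} {ν : Measure ℂ} [IsProbabilityMeasure ν]

lemma logEnergy_withDensity
    (hint : Integrable (fun p : ℂ × ℂ => Real.log ‖p.1 - p.2‖) (ν.prod ν))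
    (hdiag : ∀ᵐ p ∂ν.prod ν, p.1 ≠ p.2) {φ : ℂ → ℝ≥0} (hφ : Measurable φ) {C : ℝ}
    (hC : ∀ z, φ z ≤ C) :
    logEnergy (ν.withDensity fun z => (φ z : ℝ≥0∞)) =
      ((∫ p, (φ p.1 : ℝ) * φ p.2 * Real.log ‖p.1 - p.2‖ ∂(ν.prod ν) : ℝ) : EReal) := by
  have hφ' : Measurable fun p : ℂ × ℂ => φ p.1 * φ p.2 := by fun_prop
  have hprod : (ν.withDensity fun z => (φ z : ℝ≥0∞)).prod (ν.withDensity fun z => (φ z : ℝ≥0∞)) =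
      (ν.prod ν).withDensity fun p => ((φ p.1 * φ p.2 : ℝ≥0) : ℝ≥0∞) := by
    rw [prod_withDensity (by fun_prop) (by fun_prop)]
    simp
  rw [logEnergy_eq_integral, hprod, integral_withDensity_eq_integral_smul hφ']
  · simp [NNReal.smul_def]
  · rw [hprod, integrable_withDensity_iff_integrable_smul hφ']
    simp only [NNReal.smul_def, smul_eq_mul]
    refine hint.bdd_mul (c := C * C) (by fun_prop) (Eventually.of_forall fun p => ?_)
    rw [Real.norm_of_nonneg (NNReal.coe_nonneg _), NNReal.coe_mul]
    exact mul_le_mul (hC _) (hC _) (NNReal.coe_nonneg _) ((NNReal.coe_nonneg _).trans (hC p.1))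
  · rw [hprod]
    exact (withDensity_absolutelyContinuous _ _).ae_le hdiag

/-- By symmetry of the kernel the two terms linear in `s` coincide. -/
lemma integral_one_add_mul_log
    (hint : Integrable (fun p : ℂ × ℂ => Real.log ‖p.1 - p.2‖) (ν.prod ν))
    {ψ : ℂ → ℝ} (hψ : Measurable ψ) {C : ℝ} (hC : ∀ z, |ψ z| ≤ C) (s : ℝ) :
    ∫ p, (1 + s * ψ p.1) * (1 + s * ψ p.2) * Real.log ‖p.1 - p.2‖ ∂(ν.prod ν) =
      ∫ p, Real.log ‖p.1 - p.2‖ ∂(ν.prod ν) + 2 * s * ∫ z, ψ z * logPotential ν z ∂ν +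
        s ^ 2 * ∫ p, ψ p.1 * ψ p.2 * Real.log ‖p.1 - p.2‖ ∂(ν.prod ν) := by
  have hi1 : Integrable (fun p : ℂ × ℂ => ψ p.1 * Real.log ‖p.1 - p.2‖) (ν.prod ν) :=
    hint.bdd_mul (c := C) (Measurable.aestronglyMeasurable (by fun_prop)) (Eventually.of_forall fun p => hC _)
  have hi2 : Integrable (fun p : ℂ × ℂ => ψ p.2 * Real.log ‖p.1 - p.2‖) (ν.prod ν) :=
    hint.bdd_mul (c := C) (Measurable.aestronglyMeasurable (by fun_prop)) (Eventually.of_forall fun p => hC _)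
  have hi3 : Integrable (fun p : ℂ × ℂ => ψ p.1 * ψ p.2 * Real.log ‖p.1 - p.2‖) (ν.prod ν) := by
    refine (hi2.bdd_mul (f := fun p : ℂ × ℂ => ψ p.1) (c := C) (Measurable.aestronglyMeasurable (by fun_prop))
      (Eventually.of_forall fun p => hC _)).congr (Eventually.of_forall fun p => ?_)
    simp only; ring
  have he1 : ∫ p, ψ p.1 * Real.log ‖p.1 - p.2‖ ∂(ν.prod ν) = ∫ z, ψ z * logPotential ν z ∂ν := by
    rw [integral_prod _ hi1]
    simp only [integral_const_mul, logPotential]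
  have he2 : ∫ p, ψ p.2 * Real.log ‖p.1 - p.2‖ ∂(ν.prod ν) = ∫ z, ψ z * logPotential ν z ∂ν := by
    rw [← he1, ← integral_prod_swap]
    simp only [Prod.fst_swap, Prod.snd_swap, norm_sub_rev]
  calc _ = ∫ p, (Real.log ‖p.1 - p.2‖ + s * (ψ p.1 * Real.log ‖p.1 - p.2‖) +
          s * (ψ p.2 * Real.log ‖p.1 - p.2‖) +
          s ^ 2 * (ψ p.1 * ψ p.2 * Real.log ‖p.1 - p.2‖)) ∂(ν.prod ν) := by
        congr 1; ext p; ring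
    _ = _ := by
        have h1 : Integrable (fun p : ℂ × ℂ => Real.log ‖p.1 - p.2‖ +
            s * (ψ p.1 * Real.log ‖p.1 - p.2‖)) (ν.prod ν) := hint.add (hi1.const_mul s)
        have h2 : Integrable (fun p : ℂ × ℂ => Real.log ‖p.1 - p.2‖ +
            s * (ψ p.1 * Real.log ‖p.1 - p.2‖) + s * (ψ p.2 * Real.log ‖p.1 - p.2‖))
            (ν.prod ν) := h1.add (hi2.const_mul s)
        rw [integral_add h2 (hi3.const_mul _), integral_add h1 (hi2.const_mul s),
          integral_add hint (hi1.const_mul s), integral_const_mul, integral_const_mul,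
          integral_const_mul, he1, he2]
        ring

/-- Moving mass of an equilibrium measure away from `B` does not increase the energy. -/
lemma setIntegral_logPotential_ge (hν : IsEquilibriumMeasure K ν)
    (hint : Integrable (fun p : ℂ × ℂ => Real.log ‖p.1 - p.2‖) (ν.prod ν))
    (hdiag : ∀ᵐ p ∂ν.prod ν, p.1 ≠ p.2) {B : Set ℂ} (hB : MeasurableSet B) :
    ν.real B * ∫ p, Real.log ‖p.1 - p.2‖ ∂(ν.prod ν) ≤ ∫ z in B, logPotential ν z ∂ν := by
  set I := ∫ p, Real.log ‖p.1 - p.2‖ ∂(ν.prod ν) with hI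
  set β := ν.real B with hβ
  have hβ0 : 0 ≤ β := measureReal_nonneg
  have hβ1 : β ≤ 1 := measureReal_le_one
  -- `ψ` has mean zero, so `(1 + s ψ) ν` is again a probability measure on `K` for `0 < s ≤ 1`.
  let ψ : ℂ → ℝ := fun z => β - B.indicator 1 z
  have hψ : Measurable ψ := measurable_const.sub (measurable_one.indicator hB)
  have hψC (z : ℂ) : |ψ z| ≤ 1 := by
    by_cases hz : z ∈ B
    · simp only [ψ, Set.indicator_of_mem hz, Pi.one_apply]; rw [abs_le]; constructor <;> linarith
    · simp only [ψ, Set.indicator_of_notMem hz]; rw [abs_le]; constructor <;> linarith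
  have hpot : Integrable (logPotential ν) ν := hint.integral_prod_left
  set b := ∫ p, ψ p.1 * ψ p.2 * Real.log ‖p.1 - p.2‖ ∂(ν.prod ν) with hb
  have hlin : ∫ z, ψ z * logPotential ν z ∂ν = β * I - ∫ z in B, logPotential ν z ∂ν := by
    have hp : ∫ z, logPotential ν z ∂ν = I := (integral_prod _ hint).symm
    rw [← hp, ← integral_const_mul, ← integral_indicator hB,
      ← integral_sub (hpot.const_mul β) (hpot.indicator hB)]
    congr 1; ext z
    by_cases hz : z ∈ B <;> simp [ψ, hz, sub_mul]
  -- Maximality of `I` against the quadratic expansion, divided by `s`; letting `s → 0⁺` then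
  -- isolates the linear term.
  have key (s : ℝ) (hs0 : 0 < s) (hs1 : s ≤ 1) :
      2 * (β * I - ∫ z in B, logPotential ν z ∂ν) + s * b ≤ 0 := by
    have hnn (z : ℂ) : 0 ≤ 1 + s * ψ z := by
      have := abs_le.1 (hψC z)
      nlinarith
    let φ : ℂ → ℝ≥0 := fun z => ⟨1 + s * ψ z, hnn z⟩
    have hφ : Measurable φ := Measurable.subtype_mk (by fun_prop)
    have hφC (z : ℂ) : (φ z : ℝ) ≤ 2 := by
      have := abs_le.1 (hψC z)
      change 1 + s * ψ z ≤ 2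
      nlinarith
    have hψint : Integrable ψ ν :=
      (integrable_const β).sub ((integrable_const 1).indicator hB)
    have hψ0 : ∫ z, ψ z ∂ν = 0 := by
      have : ∫ z, ψ z ∂ν = ∫ _, β ∂ν - ∫ z, B.indicator 1 z ∂ν :=
        integral_sub (integrable_const β) ((integrable_const 1).indicator hB)
      rw [this, integral_indicator_one hB]
      simp [β]
    have hφint : Integrable (fun z => 1 + s * ψ z) ν := (integrable_const _).add (hψint.const_mul s)
    have hmass : ∫ z, (1 + s * ψ z) ∂ν = 1 := by
      rw [integral_add (integrable_const _) (hψint.const_mul s), integral_const_mul, hψ0]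
      simp
    have hprob : IsProbabilityMeasure (ν.withDensity fun z => (φ z : ℝ≥0∞)) := by
      constructor
      rw [withDensity_apply _ MeasurableSet.univ, Measure.restrict_univ]
      have : ∀ z, (φ z : ℝ≥0∞) = ENNReal.ofReal (1 + s * ψ z) := fun z => by
        rw [ENNReal.ofReal, Real.toNNReal_of_nonneg (hnn z)]; rfl
      simp only [this]
      rw [← ofReal_integral_eq_lintegral_ofReal hφint
        (Eventually.of_forall hnn), hmass, ENNReal.ofReal_one]
    have hsupp : (ν.withDensity fun z => (φ z : ℝ≥0∞)).support ⊆ K :=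
      ((withDensity_absolutelyContinuous _ _).support_mono).trans hν.support_subset
    have hle := hν.logEnergy_le _ hprob hsupp
    rw [logEnergy_withDensity hint hdiag hφ hφC, logEnergy_eq_integral hint hdiag,
      EReal.coe_le_coe_iff] at hle
    have hexp := integral_one_add_mul_log hint hψ hψC s
    change ∫ p : ℂ × ℂ, (1 + s * ψ p.1) * (1 + s * ψ p.2) * Real.log ‖p.1 - p.2‖ ∂(ν.prod ν)
      ≤ I at hle
    rw [hexp, hlin, ← hb, ← hI] at hle
    have : s * (2 * (β * I - ∫ z in B, logPotential ν z ∂ν) + s * b) ≤ 0 := by linarith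
    exact nonpos_of_mul_nonpos_right this hs0
  have hlim : Tendsto (fun s : ℝ => 2 * (β * I - ∫ z in B, logPotential ν z ∂ν) + s * b)
      (𝓝[>] 0) (𝓝 (2 * (β * I - ∫ z in B, logPotential ν z ∂ν) + 0 * b)) := by
    refine Tendsto.mono_left (Continuous.tendsto (by fun_prop) 0) nhdsWithin_le_nhds
  have := le_of_tendsto hlim (by
    filter_upwards [Ioc_mem_nhdsGT (zero_lt_one' ℝ)] with s hs using key s hs.1 hs.2)
  linarith

lemma ae_le_logPotential (hν : IsEquilibriumMeasure K ν)
    (hint : Integrable (fun p : ℂ × ℂ => Real.log ‖p.1 - p.2‖) (ν.prod ν))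
    (hdiag : ∀ᵐ p ∂ν.prod ν, p.1 ≠ p.2) :
    ∀ᵐ z ∂ν, ∫ p, Real.log ‖p.1 - p.2‖ ∂(ν.prod ν) ≤ logPotential ν z := by
  refine ae_le_of_forall_setIntegral_le (integrable_const _) hint.integral_prod_left
    fun B hB _ => ?_
  rw [setIntegral_const, smul_eq_mul]
  exact setIntegral_logPotential_ge hν hint hdiag hB

end Variation

/-! ### From almost every point to every point of the support. -/

section Support

variable {K : Set ℂ} {ν : Measure ℂ} [IsProbabilityMeasure ν]

lemma continuous_truncPotential (hK : IsCompact K) (hνK : ∀ᵐ z ∂ν, z ∈ K) (m : ℕ) :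
    Continuous (truncPotential ν m) := by
  have h := continuous_parametric_integral_of_continuous (μ := ν)
    (f := fun z w : ℂ => Real.log (max ‖z - w‖ (1 / (m + 1)))) (continuous_log_max_norm_sub m) hK
  rwa [Measure.restrict_eq_self_of_ae_mem hνK] at h

lemma integrable_log_max (hK : IsCompact K) (hνK : ∀ᵐ z ∂ν, z ∈ K) (m : ℕ) (z : ℂ) :
    Integrable (fun w => Real.log (max ‖z - w‖ (1 / (m + 1)))) ν := by
  have hc : Continuous fun w => Real.log (max ‖z - w‖ (1 / (m + 1))) :=
    (continuous_log_max_norm_sub m).comp (by fun_prop : Continuous fun w : ℂ => (z, w))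
  have := hc.continuousOn.integrableOn_compact (μ := ν) hK
  rwa [IntegrableOn, Measure.restrict_eq_self_of_ae_mem hνK] at this

/-- The truncated potential is continuous and dominates `U` a.e., so the a.e. bound holds on a
closed set of full measure, which contains the support. -/
lemma le_truncPotential_of_mem_support (hK : IsCompact K) (hν : IsEquilibriumMeasure K ν)
    (hνK : ∀ᵐ z ∂ν, z ∈ K)
    (hint : Integrable (fun p : ℂ × ℂ => Real.log ‖p.1 - p.2‖) (ν.prod ν))
    (hdiag : ∀ᵐ p ∂ν.prod ν, p.1 ≠ p.2) (m : ℕ) {z : ℂ} (hz : z ∈ ν.support) :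
    ∫ p, Real.log ‖p.1 - p.2‖ ∂(ν.prod ν) ≤ truncPotential ν m z := by
  have hcl : IsClosed {z | ∫ p, Real.log ‖p.1 - p.2‖ ∂(ν.prod ν) ≤ truncPotential ν m z} :=
    isClosed_le continuous_const (continuous_truncPotential hK hνK m)
  refine Measure.support_subset_of_isClosed hcl ?_ hz
  filter_upwards [ae_le_logPotential hν hint hdiag, hint.prod_right_ae] with z hz hzi
  refine hz.trans (integral_mono_ae hzi (integrable_log_max hK hνK m z) ?_)
  filter_upwards [ae_ne_of_ae_prod_ne hdiag z] with w hw
  exact Real.log_le_log (norm_pos_iff.2 (sub_ne_zero.2 hw.symm)) (le_max_left _ _)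

/-- Monotone convergence for `R - log`, whose truncated integrals are at most `R - I`. Integrability
is part of the conclusion because the Bochner integral defining `logPotential` is `0` without it. -/
lemma integrable_and_le_logPotential_of_forall_truncPotential (hK : IsCompact K)
    (hνK : ∀ᵐ z ∂ν, z ∈ K) (hatom : ∀ z, ∀ᵐ w ∂ν, w ≠ z) {I : ℝ} {z : ℂ} (hzK : z ∈ K)
    (hI : ∀ m, I ≤ truncPotential ν m z) :
    Integrable (fun w => Real.log ‖z - w‖) ν ∧ I ≤ logPotential ν z := by
  obtain ⟨R, hR, hRK⟩ := exists_norm_sub_le_exp hK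
  have hne := hatom z
  have hlogle : ∀ᵐ w ∂ν, Real.log ‖z - w‖ ≤ R := by
    filter_upwards [hνK, hne] with w hw hwz
    rw [Real.log_le_iff_le_exp (norm_pos_iff.2 (sub_ne_zero.2 hwz.symm))]
    exact hRK _ hzK _ hw
  have hmaxle (m : ℕ) (w : ℂ) (hw : w ∈ K) : Real.log (max ‖z - w‖ (1 / (m + 1))) ≤ R := by
    rw [Real.log_le_iff_le_exp (lt_max_of_lt_right (by positivity))]
    refine max_le (hRK _ hzK _ hw) ?_
    have : (1 : ℝ) / (m + 1) ≤ 1 := by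
      rw [div_le_one (by positivity)]; simp
    exact this.trans (Real.one_le_exp hR)
  have hmeas : Measurable fun w => R - Real.log ‖z - w‖ := by fun_prop
  have hbound : ∫⁻ w, ENNReal.ofReal (R - Real.log ‖z - w‖) ∂ν ≤ ENNReal.ofReal (R - I) := by
    have h1 : ∫⁻ w, ENNReal.ofReal (R - Real.log ‖z - w‖) ∂ν ≤
        ∫⁻ w, ⨆ m, (truncKernel R m (z, w) : ℝ≥0∞) ∂ν := by
      refine lintegral_mono_ae ?_
      filter_upwards [hne] with w hw
      obtain ⟨m, hm⟩ := exists_nat_one_div_lt (norm_pos_iff.2 (sub_ne_zero.2 hw.symm))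
      refine le_iSup_of_le m ?_
      simp only [truncKernel]
      rw [max_eq_left hm.le]
      rfl
    refine h1.trans ?_
    have hmk (m : ℕ) : Measurable fun w => (truncKernel R m (z, w) : ℝ≥0∞) :=
      ((continuous_truncKernel R m).comp (Continuous.prodMk_right z)).measurable.coe_nnreal_ennreal
    rw [lintegral_iSup hmk
      (fun m n hmn w => ENNReal.coe_le_coe.2 (monotone_truncKernel R (z, w) hmn))]
    refine iSup_le fun m => ?_
    have hmint := integrable_log_max hK hνK m z
    have hRint : Integrable (fun w => R - Real.log (max ‖z - w‖ (1 / (m + 1)))) ν :=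
      (integrable_const R).sub hmint
    change ∫⁻ w, ENNReal.ofReal (R - Real.log (max ‖z - w‖ (1 / (m + 1)))) ∂ν ≤ _
    rw [← ofReal_integral_eq_lintegral_ofReal hRint
      (hνK.mono fun w hw => sub_nonneg.2 (hmaxle m w hw))]
    refine ENNReal.ofReal_le_ofReal ?_
    have := hI m
    rw [truncPotential] at this
    rw [integral_sub (integrable_const R) hmint, integral_const, probReal_univ, one_smul]
    linarith
  have hnn : 0 ≤ᵐ[ν] fun w => R - Real.log ‖z - w‖ := hlogle.mono fun w hw => sub_nonneg.2 hw
  have hint' : Integrable (fun w => R - Real.log ‖z - w‖) ν :=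
    ⟨hmeas.aestronglyMeasurable, (hasFiniteIntegral_iff_ofReal hnn).2
      (hbound.trans_lt ENNReal.ofReal_lt_top)⟩
  have hint : Integrable (fun w => Real.log ‖z - w‖) ν := by
    refine ((integrable_const R).sub hint').congr (Eventually.of_forall fun w => ?_)
    simp
  refine ⟨hint, ?_⟩
  rw [← ofReal_integral_eq_lintegral_ofReal hint' hnn] at hbound
  have hRI : 0 ≤ R - I := by
    have h0 := hI 0
    have : truncPotential ν 0 z ≤ ∫ _, R ∂ν := by
      exact integral_mono_ae (integrable_log_max hK hνK 0 z) (integrable_const R)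
        (hνK.mono fun w hw => hmaxle 0 w hw)
    simp only [integral_const, probReal_univ, one_smul] at this
    linarith
  rw [ENNReal.ofReal_le_ofReal_iff hRI, integral_sub (integrable_const R) hint] at hbound
  simp only [integral_const, probReal_univ, one_smul] at hbound
  rw [logPotential]
  linarith

end Support

/-! ### Continuity, mean value and minimum principles for potentials. -/

section MinimumPrinciple

variable {S : Set ℂ} {ν : Measure ℂ}

lemma ae_log_eq_log_max (hνS : ∀ᵐ w ∂ν, w ∈ S) {z : ℂ} {m : ℕ}
    (hm : 1 / ((m : ℝ) + 1) ≤ Metric.infDist z S) :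
    ∀ᵐ w ∂ν, Real.log ‖z - w‖ = Real.log (max ‖z - w‖ (1 / (m + 1))) := by
  filter_upwards [hνS] with w hw
  have := Metric.infDist_le_dist_of_mem (x := z) hw
  rw [dist_eq_norm] at this
  rw [max_eq_left (hm.trans this)]

lemma logPotential_eq_truncPotential (hνS : ∀ᵐ w ∂ν, w ∈ S) {z : ℂ} {m : ℕ}
    (hm : 1 / ((m : ℝ) + 1) ≤ Metric.infDist z S) :
    logPotential ν z = truncPotential ν m z :=
  integral_congr_ae (ae_log_eq_log_max hνS hm)

variable [IsProbabilityMeasure ν]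

lemma integrable_log_of_notMem (hS : IsCompact S) (hne : S.Nonempty) (hνS : ∀ᵐ w ∂ν, w ∈ S)
    {z : ℂ} (hz : z ∉ S) : Integrable (fun w => Real.log ‖z - w‖) ν := by
  obtain ⟨m, hm⟩ := exists_nat_one_div_lt ((hS.isClosed.notMem_iff_infDist_pos hne).1 hz)
  exact (integrable_log_max hS hνS m z).congr ((ae_log_eq_log_max hνS hm.le).mono
    fun w hw => hw.symm)

lemma continuousAt_logPotential (hS : IsCompact S) (hne : S.Nonempty) (hνS : ∀ᵐ w ∂ν, w ∈ S)
    {z : ℂ} (hz : z ∉ S) : ContinuousAt (logPotential ν) z := by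
  obtain ⟨m, hm⟩ := exists_nat_one_div_lt ((hS.isClosed.notMem_iff_infDist_pos hne).1 hz)
  refine (continuous_truncPotential hS hνS m).continuousAt.congr ?_
  filter_upwards [(Metric.continuous_infDist_pt S).continuousAt.eventually (lt_mem_nhds hm)]
    with y hy using (logPotential_eq_truncPotential hνS hy.le).symm

/-- The continuity principle: near a point of `S`, the potential is not much smaller than its
infimum over `S`. -/
lemma eventually_le_logPotential (hS : IsCompact S) (hne : S.Nonempty) (hνS : ∀ᵐ w ∂ν, w ∈ S)
    (hatom : ∀ z, ∀ᵐ w ∂ν, w ≠ z) {I : ℝ}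
    (hI : ∀ z ∈ S, Integrable (fun w => Real.log ‖z - w‖) ν ∧ I ≤ logPotential ν z)
    (ζ : ℂ) (hζ : ζ ∈ S) {c : ℝ} (hc : c < I) :
    ∀ᶠ z in 𝓝[Sᶜ] ζ, c < logPotential ν z := by
  -- If `ξ ∈ S` is nearest to `z` and `d = |z - ξ|`, then `|ξ - w| ≤ |z - w| (1 + d / |z - w|)`, so
  -- `U(ξ) ≤ U(z) + ∫ F z`. For `w ∈ S` one has `F ≤ log 2`, and `F → 0` as `z → ζ` unless `w = ζ`,
  -- which is not an atom; dominated convergence applies.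
  let F : ℂ → ℂ → ℝ := fun z w => Real.log (1 + Metric.infDist z S / ‖z - w‖)
  have hFm (z : ℂ) : Measurable (F z) := by fun_prop
  have hFb (z : ℂ) : ∀ᵐ w ∂ν, ‖F z w‖ ≤ Real.log 2 := by
    filter_upwards [hνS] with w hw
    have h1 : Metric.infDist z S ≤ ‖z - w‖ := by
      rw [← dist_eq_norm]; exact Metric.infDist_le_dist_of_mem hw
    have h2 : 0 ≤ Metric.infDist z S / ‖z - w‖ := div_nonneg Metric.infDist_nonneg (norm_nonneg _)
    have h3 : Metric.infDist z S / ‖z - w‖ ≤ 1 := div_le_one_of_le₀ h1 (norm_nonneg _)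
    rw [Real.norm_of_nonneg (Real.log_nonneg (by linarith))]
    exact Real.log_le_log (by linarith) (by linarith)
  have hFint (z : ℂ) : Integrable (F z) ν :=
    (integrable_const (Real.log 2)).mono' (hFm z).aestronglyMeasurable (hFb z)
  have hlim : Tendsto (fun z => ∫ w, F z w ∂ν) (𝓝[Sᶜ] ζ) (𝓝 (∫ _, (0 : ℝ) ∂ν)) := by
    refine tendsto_integral_filter_of_dominated_convergence (fun _ => Real.log 2)
      (Eventually.of_forall fun z => (hFm z).aestronglyMeasurable) (Eventually.of_forall hFb)
      (integrable_const _) ?_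
    filter_upwards [hatom ζ] with w hw
    have hd : ContinuousAt (fun z => F z w) ζ := by
      have h0 : ‖ζ - w‖ ≠ 0 := norm_ne_zero_iff.2 (sub_ne_zero.2 hw.symm)
      have h1 : ContinuousAt (fun z => 1 + Metric.infDist z S / ‖z - w‖) ζ :=
        continuousAt_const.add
          ((Metric.continuous_infDist_pt S).continuousAt.div (by fun_prop) h0)
      refine h1.log ?_
      rw [Metric.infDist_zero_of_mem hζ]
      simp
    have := hd.tendsto
    simp only [F, Metric.infDist_zero_of_mem hζ, zero_div, add_zero, Real.log_one] at this
    exact this.mono_left nhdsWithin_le_nhds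
  rw [integral_zero] at hlim
  filter_upwards [hlim.eventually (gt_mem_nhds (sub_pos.2 hc)), self_mem_nhdsWithin] with z hz hzS
  obtain ⟨ξ, hξS, hξ⟩ := hS.exists_infDist_eq_dist hne z
  have hzint := integrable_log_of_notMem hS hne hνS hzS
  have hle : logPotential ν ξ ≤ logPotential ν z + ∫ w, F z w ∂ν := by
    rw [logPotential, logPotential, ← integral_add hzint (hFint z)]
    refine integral_mono_ae (hI ξ hξS).1 (hzint.add (hFint z)) ?_
    filter_upwards [hνS, hatom ξ] with w hw hwξ
    have hzw : 0 < ‖z - w‖ := by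
      rw [norm_pos_iff, sub_ne_zero]
      rintro rfl
      exact hzS hw
    have hpos : 0 < 1 + Metric.infDist z S / ‖z - w‖ := by
      have := div_nonneg (Metric.infDist_nonneg (x := z) (s := S)) hzw.le
      linarith
    simp only [F]
    rw [← Real.log_mul hzw.ne' hpos.ne']
    refine Real.log_le_log (norm_pos_iff.2 (sub_ne_zero.2 hwξ.symm)) ?_
    rw [mul_add, mul_one, mul_div_cancel₀ _ hzw.ne', hξ, dist_eq_norm, add_comm]
    calc ‖ξ - w‖ = ‖(z - w) - (z - ξ)‖ := by ring_nf
      _ ≤ ‖z - w‖ + ‖z - ξ‖ := norm_sub_le _ _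
      _ = _ := add_comm _ _
  have := (hI ξ hξS).2
  linarith

/-- The mean value property of `log |· - w|` on discs not containing `w`, integrated in `w` by
Fubini. -/
lemma circleAverage_logPotential (hS : IsCompact S) (hνS : ∀ᵐ w ∂ν, w ∈ S)
    {z : ℂ} {r : ℝ} (hr : 0 < r) (hrS : r < Metric.infDist z S) :
    Real.circleAverage (logPotential ν) z r = logPotential ν z := by
  -- The circle stays at distance more than `1 / (m + 1)` from `S`, so the kernel may be replaced by
  -- its continuous truncation, for which Fubini is immediate.
  obtain ⟨m, hm⟩ := exists_nat_one_div_lt (sub_pos.2 hrS)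
  have hdist (θ : ℝ) : 1 / ((m : ℝ) + 1) ≤ Metric.infDist (circleMap z r θ) S := by
    have h1 := Metric.infDist_le_infDist_add_dist (s := S) (x := z) (y := circleMap z r θ)
    rw [dist_comm, dist_eq_norm, circleMap_sub_center, norm_circleMap_zero,
      abs_of_pos hr] at h1
    linarith
  have hae : ∀ᵐ w ∂ν, ∫ θ in 0..2 * Real.pi,
      Real.log (max ‖circleMap z r θ - w‖ (1 / (m + 1))) = 2 * Real.pi * Real.log ‖z - w‖ := by
    filter_upwards [hνS] with w hw
    have hzw : r < ‖z - w‖ := by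
      rw [← dist_eq_norm]
      exact hrS.trans_le (Metric.infDist_le_dist_of_mem hw)
    have hmv := circleAverage_log_norm_sub_const_eq_log_radius_add_posLog (a := w) (c := z) hr.ne'
    rw [Real.posLog_eq_log, Real.log_mul (inv_ne_zero hr.ne') (hr.trans hzw).ne', Real.log_inv,
      add_neg_cancel_left, Real.circleAverage, smul_eq_mul,
      inv_mul_eq_iff_eq_mul₀ (by positivity)] at hmv
    · rw [← hmv]
      refine intervalIntegral.integral_congr fun θ _ => ?_
      have := Metric.infDist_le_dist_of_mem (x := circleMap z r θ) hw
      rw [dist_eq_norm] at this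
      rw [max_eq_left ((hdist θ).trans this)]
    · rw [abs_of_nonneg (by positivity), inv_mul_eq_div, one_le_div hr]
      exact hzw.le
  have hint : Integrable (Function.uncurry fun (θ : ℝ) (w : ℂ) =>
      Real.log (max ‖circleMap z r θ - w‖ (1 / (m + 1))))
      ((volume.restrict (Set.uIoc 0 (2 * Real.pi))).prod ν) := by
    have hc : Continuous (Function.uncurry fun (θ : ℝ) (w : ℂ) =>
        Real.log (max ‖circleMap z r θ - w‖ (1 / (m + 1)))) :=
      (continuous_log_max_norm_sub m).comp
        (((continuous_circleMap z r).comp continuous_fst).prodMk continuous_snd)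
    have h := hc.continuousOn.integrableOn_compact (μ := volume.prod ν)
      ((isCompact_uIcc (a := 0) (b := 2 * Real.pi)).prod hS)
    have h' := h.mono_set (Set.prod_mono_left (t := S) (Set.uIoc_subset_uIcc (a := 0)
      (b := 2 * Real.pi)))
    rwa [IntegrableOn, ← Measure.prod_restrict, Measure.restrict_eq_self_of_ae_mem hνS] at h'
  rw [Real.circleAverage, smul_eq_mul]
  have h1 : ∫ θ in 0..2 * Real.pi, logPotential ν (circleMap z r θ) =
      ∫ θ in 0..2 * Real.pi, ∫ w, Real.log (max ‖circleMap z r θ - w‖ (1 / (m + 1))) ∂ν :=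
    intervalIntegral.integral_congr fun θ _ => logPotential_eq_truncPotential hνS (hdist θ)
  rw [h1, intervalIntegral_integral_swap hint, integral_congr_ae hae, integral_const_mul,
    ← logPotential, inv_mul_cancel_left₀ (by positivity)]

/-- The minimum principle: a potential that is at least `I` on the compact set `S` carrying the
measure is at least `I` everywhere. -/
theorem le_logPotential_of_le_on (hS : IsCompact S) (hne : S.Nonempty) (hνS : ∀ᵐ w ∂ν, w ∈ S)
    (hatom : ∀ z, ∀ᵐ w ∂ν, w ≠ z) {I : ℝ}
    (hI : ∀ z ∈ S, Integrable (fun w => Real.log ‖z - w‖) ν ∧ I ≤ logPotential ν z) (z : ℂ) :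
    Integrable (fun w => Real.log ‖z - w‖) ν ∧ I ≤ logPotential ν z := by
  by_cases hzS : z ∈ S
  · exact hI z hzS
  refine ⟨integrable_log_of_notMem hS hne hνS hzS, ?_⟩
  by_contra! hlt
  -- The continuity principle keeps these sublevel sets from accumulating at `S`.
  have hclosed (c : ℝ) (hc : c < I) : IsClosed {y | y ∉ S ∧ logPotential ν y ≤ c} := by
    rw [← isOpen_compl_iff, isOpen_iff_mem_nhds]
    intro y hy
    by_cases hyS : y ∈ S
    · filter_upwards [eventually_nhdsWithin_iff.1
        (eventually_le_logPotential hS hne hνS hatom hI y hyS hc)] with x hx hx'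
      exact absurd (hx hx'.1) (not_lt.2 hx'.2)
    · have hy' : c < logPotential ν y := by
        by_contra! h
        exact hy ⟨hyS, h⟩
      filter_upwards [(continuousAt_logPotential hS hne hνS hyS).eventually (lt_mem_nhds hy')]
        with x hx hx'
      exact absurd hx (not_lt.2 hx'.2)
  have hbdd (c : ℝ) (hc : c < I) : Bornology.IsBounded {y | y ∉ S ∧ logPotential ν y ≤ c} := by
    obtain ⟨C, hC⟩ := hS.isBounded.exists_norm_le
    refine (Metric.isBounded_closedBall (x := (0 : ℂ)) (r := C + Real.exp I)).subset ?_
    rintro y ⟨hyS, hy⟩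
    rw [mem_closedBall_zero_iff]
    by_contra! hy'
    have : ∫ _, I ∂ν ≤ logPotential ν y := by
      refine integral_mono_ae (integrable_const I) (integrable_log_of_notMem hS hne hνS hyS) ?_
      filter_upwards [hνS] with w hw
      have h1 := norm_sub_norm_le y w
      have h2 := hC w hw
      have h3 : Real.exp I ≤ ‖y - w‖ := by linarith
      rwa [Real.le_log_iff_exp_le ((Real.exp_pos I).trans_le h3)]
    simp only [integral_const, probReal_univ, one_smul] at this
    linarith
  have hcompact (c : ℝ) (hc : c < I) : IsCompact {y | y ∉ S ∧ logPotential ν y ≤ c} :=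
    Metric.isCompact_of_isClosed_isBounded (hclosed c hc) (hbdd c hc)
  obtain ⟨x, ⟨hxS, hxz⟩, hxmin⟩ := (hcompact _ hlt).exists_isMinOn ⟨z, hzS, le_rfl⟩
    (fun y hy => (continuousAt_logPotential hS hne hνS hy.1).continuousWithinAt)
  have hglob (y : ℂ) (hy : y ∉ S) : logPotential ν x ≤ logPotential ν y := by
    rcases le_total (logPotential ν y) (logPotential ν z) with h | h
    · exact hxmin ⟨hy, h⟩
    · exact hxz.trans h
  -- Among the minimum points of `U` off `S`, `y` is nearest to `S`. The mean value property forces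
  -- `U` to be minimal on the whole circle of radius `d / 2` about `y`, which contains a point
  -- nearer to `S`. This takes the place of a connectedness argument.
  obtain ⟨y, ⟨hyS, hyx⟩, hymin⟩ := (hcompact _ (hxz.trans_lt hlt)).exists_isMinOn
    ⟨x, hxS, le_rfl⟩ (Metric.continuous_infDist_pt S).continuousOn
  have hglob' (u : ℂ) (hu : u ∉ S) : logPotential ν y ≤ logPotential ν u :=
    hyx.trans (hglob u hu)
  set d := Metric.infDist y S with hd
  have hd0 : 0 < d := (hS.isClosed.notMem_iff_infDist_pos hne).1 hyS
  obtain ⟨ξ, hξS, hξ⟩ := hS.exists_infDist_eq_dist hne y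
  have hr : d / 2 < Metric.infDist y S := by rw [← hd]; linarith
  have hcirc (θ : ℝ) : circleMap y (d / 2) θ ∉ S := by
    intro hmem
    have := Metric.infDist_le_dist_of_mem (x := y) hmem
    rw [dist_comm, dist_eq_norm, circleMap_sub_center, norm_circleMap_zero,
      abs_of_pos (by positivity)] at this
    linarith
  have hcont : Continuous fun θ => logPotential ν (circleMap y (d / 2) θ) :=
    continuous_iff_continuousAt.2 fun θ =>
      (continuousAt_logPotential hS hne hνS (hcirc θ)).comp (continuous_circleMap _ _).continuousAt
  have havg := circleAverage_logPotential hS hνS (by positivity : 0 < d / 2) hr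
  have hzero : ∫ θ in 0..2 * Real.pi,
      (logPotential ν (circleMap y (d / 2) θ) - logPotential ν y) = 0 := by
    rw [intervalIntegral.integral_sub (hcont.intervalIntegrable _ _)
      intervalIntegrable_const, intervalIntegral.integral_const]
    rw [Real.circleAverage, smul_eq_mul, inv_mul_eq_iff_eq_mul₀ (by positivity)] at havg
    rw [havg]
    simp
  -- The midpoint between `y` and its nearest point `ξ` of `S`.
  obtain ⟨θ, hθ, hθξ⟩ : ∃ θ ∈ Set.Icc 0 (2 * Real.pi),
      circleMap y (d / 2) θ = y + (ξ - y) / 2 := by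
    have hsph : y + (ξ - y) / 2 ∈ Metric.sphere y |d / 2| := by
      rw [abs_of_pos (by positivity), mem_sphere_iff_norm, add_sub_cancel_left, norm_div,
        ← dist_eq_norm, dist_comm, ← hξ]
      simp [hd]
    rw [← image_circleMap_Ioc] at hsph
    obtain ⟨θ, hθ, h⟩ := hsph
    exact ⟨θ, Set.Ioc_subset_Icc_self hθ, h⟩
  have hle : logPotential ν (circleMap y (d / 2) θ) ≤ logPotential ν y := by
    by_contra! hpos
    have := intervalIntegral.integral_pos (a := 0) (b := 2 * Real.pi) (by positivity)
      (hcont.sub continuous_const).continuousOn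
      (fun θ _ => sub_nonneg.2 (hglob' _ (hcirc θ))) ⟨θ, hθ, sub_pos.2 hpos⟩
    exact this.ne' hzero
  have hmin := hymin (a := circleMap y (d / 2) θ) ⟨hcirc θ, hle.trans hyx⟩
  have hlt' : Metric.infDist (circleMap y (d / 2) θ) S ≤ d / 2 := by
    refine (Metric.infDist_le_dist_of_mem hξS).trans_eq ?_
    rw [hθξ, dist_eq_norm, show y + (ξ - y) / 2 - ξ = (y - ξ) / 2 by ring, norm_div,
      ← dist_eq_norm, ← hξ]
    simp [hd]
  have : d ≤ Metric.infDist (circleMap y (d / 2) θ) S := hmin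
  linarith

end MinimumPrinciple

/-- Frostman's theorem: the potential of an equilibrium measure is bounded below by the energy. -/
theorem IsEquilibriumMeasure.integrable_and_le_logPotential {K : Set ℂ} (hK : IsCompact K)
    {ν : Measure ℂ} [IsProbabilityMeasure ν] (hν : IsEquilibriumMeasure K ν)
    (hint : Integrable (fun p : ℂ × ℂ => Real.log ‖p.1 - p.2‖) (ν.prod ν))
    (hdiag : ∀ᵐ p ∂ν.prod ν, p.1 ≠ p.2) (z : ℂ) :
    Integrable (fun w => Real.log ‖z - w‖) ν ∧
      ∫ p, Real.log ‖p.1 - p.2‖ ∂(ν.prod ν) ≤ logPotential ν z := by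
  have hνS : ∀ᵐ w ∂ν, w ∈ ν.support := Measure.support_mem_ae
  have hνK : ∀ᵐ w ∂ν, w ∈ K := hνS.mono fun w hw => hν.support_subset hw
  refine le_logPotential_of_le_on (hK.of_isClosed_subset Measure.isClosed_support hν.support_subset)
    (Measure.nonempty_support (IsProbabilityMeasure.ne_zero ν)) hνS
    (ae_ne_of_ae_prod_ne hdiag) (fun ζ hζ => ?_) z
  exact integrable_and_le_logPotential_of_forall_truncPotential hK hνK
    (ae_ne_of_ae_prod_ne hdiag) (hν.support_subset hζ)
    fun m => le_truncPotential_of_mem_support hK hν hνK hint hdiag m hζ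

/-! ### Monic polynomials of least `L²` norm. -/

section Minimizer

open Polynomial

lemma memLp_eval {L : Set ℂ} (hL : IsCompact L) {μ : Measure ℂ} [IsFiniteMeasure μ]
    (hμ : ∀ᵐ z ∂μ, z ∈ L) (P : ℂ[X]) : MemLp (fun z => P.eval z) 2 μ := by
  obtain ⟨C, hC⟩ := hL.exists_bound_of_continuousOn P.continuous.continuousOn
  exact MemLp.of_bound P.continuous.aestronglyMeasurable C (hμ.mono hC)

/-- The minimizer is `X ^ n` minus its best approximation by polynomials of degree below `n`. Their
image in `L²` is finite-dimensional, hence complete, even when evaluation is not injective. -/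
theorem exists_isMonicMinimizer {L : Set ℂ} (hL : IsCompact L) {μ : Measure ℂ} [IsFiniteMeasure μ]
    (hμ : ∀ᵐ z ∂μ, z ∈ L) (n : ℕ) : ∃ P, IsMonicMinimizer μ n P := by
  let T : ℂ[X] →ₗ[ℂ] Lp ℂ 2 μ :=
    { toFun := fun P => (memLp_eval hL hμ P).toLp _
      map_add' := fun P Q => by
        rw [← MemLp.toLp_add]
        simp only [eval_add]
        rfl
      map_smul' := fun c P => by
        rw [RingHom.id_apply, ← MemLp.toLp_const_smul]
        simp only [eval_smul]
        rfl }
  have hT (P : ℂ[X]) : polyNorm μ P = ‖T P‖ₑ := (Lp.enorm_toLp (memLp_eval hL hμ P)).symm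
  obtain ⟨v, ⟨q, hq, rfl⟩, hmin⟩ := Submodule.exists_norm_eq_iInf_of_complete_subspace
    ((degreeLT ℂ n).map T) (Submodule.complete_of_finiteDimensional _) (T (X ^ n))
  have hq' : q.degree < n := mem_degreeLT.1 hq
  refine ⟨X ^ n - q, monic_X_pow_sub hq', ?_, fun Q hQ hQn => ?_⟩
  · refine natDegree_eq_of_degree_eq_some ?_
    rw [degree_sub_eq_left_of_degree_lt (by rwa [degree_X_pow]), degree_X_pow]
  · have hmem : X ^ n - Q ∈ degreeLT ℂ n := by
      rw [mem_degreeLT]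
      have hdeg : Q.degree = n := by rw [degree_eq_natDegree hQ.ne_zero, hQn]
      have := degree_sub_lt_left (p := X ^ n) (q := Q) (by rw [degree_X_pow, hdeg])
        (pow_ne_zero _ X_ne_zero) (by rw [hQ.leadingCoeff, leadingCoeff_X_pow])
      rwa [degree_X_pow] at this
    have hbdd : BddBelow (Set.range fun w : (degreeLT ℂ n).map T => ‖T (X ^ n) - w‖) :=
      ⟨0, by rintro _ ⟨w, rfl⟩; exact norm_nonneg _⟩
    have hle : ‖T (X ^ n - q)‖ ≤ ‖T Q‖ := by
      have h := hmin.trans_le (ciInf_le hbdd ⟨T (X ^ n - Q), Submodule.mem_map_of_mem hmem⟩)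
      simpa only [map_sub, sub_sub_cancel] using h
    rw [hT, hT]
    exact enorm_le_iff_norm_le.2 hle

lemma isMonicMinimizer_monicOrthogonalPolynomial {L : Set ℂ} (hL : IsCompact L) {μ : Measure ℂ}
    [IsFiniteMeasure μ] (hμ : ∀ᵐ z ∂μ, z ∈ L) (n : ℕ) :
    IsMonicMinimizer μ n (monicOrthogonalPolynomial μ n) := by
  have h := exists_isMonicMinimizer hL hμ n
  rw [monicOrthogonalPolynomial, dif_pos h]
  exact h.choose_spec

lemma polyNorm_sq (μ : Measure ℂ) (P : ℂ[X]) : polyNorm μ P ^ 2 = ∫⁻ z, ‖P.eval z‖ₑ ^ 2 ∂μ := by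
  have := eLpNorm_nnreal_pow_eq_lintegral (μ := μ) (f := fun z => P.eval z) (p := 2) two_ne_zero
  simpa [polyNorm] using this

end Minimizer

/-! ### Energy and capacity of the equilibrium measure. -/

section Equilibrium

/-- Normalizing a nonzero finite measure preserves its support and the finiteness of its energy. -/
lemma IsPolar.of_forall_logEnergy {K : Set ℂ} (h : ∀ ν : Measure ℂ, IsProbabilityMeasure ν →
    IsCompact ν.support → ν.support ⊆ K → logEnergy ν = ⊥) : IsPolar K := by
  intro ν hfin hν hc hs
  have hne : ν Set.univ ≠ 0 := by rwa [Ne, Measure.measure_univ_eq_zero]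
  have hac : (ν Set.univ)⁻¹ • ν ≪ ν := Measure.smul_absolutelyContinuous
  have hac' : ν ≪ (ν Set.univ)⁻¹ • ν :=
    Measure.absolutelyContinuous_smul (ENNReal.inv_ne_zero.2 (measure_ne_top ν _))
  have hprob : IsProbabilityMeasure ((ν Set.univ)⁻¹ • ν) :=
    ⟨by simp [ENNReal.inv_mul_cancel hne (measure_ne_top ν _)]⟩
  have hsupp : ((ν Set.univ)⁻¹ • ν).support = ν.support :=
    Set.Subset.antisymm hac.support_mono hac'.support_mono
  by_contra hbot
  obtain ⟨hint, hdiag⟩ := integrable_log_of_logEnergy_ne_bot hc Measure.support_mem_ae hbot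
  have hprod : ((ν Set.univ)⁻¹ • ν).prod ((ν Set.univ)⁻¹ • ν) =
      (ν Set.univ)⁻¹ • (ν Set.univ)⁻¹ • ν.prod ν := by
    rw [Measure.prod_smul_left, Measure.prod_smul_right]
  have hfin' : (ν Set.univ)⁻¹ ≠ ∞ := ENNReal.inv_ne_top.2 hne
  have hE := logEnergy_eq_integral (ν := (ν Set.univ)⁻¹ • ν)
    (by rw [hprod]; exact (hint.smul_measure hfin').smul_measure hfin')
    ((hac.prod hac).ae_le hdiag)
  rw [h _ hprob (hsupp ▸ hc) (hsupp ▸ hs)] at hE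
  exact EReal.coe_ne_bot _ hE.symm

lemma isEquilibriumMeasure_equilibriumMeasure {K : Set ℂ} (hK : IsCompact K)
    (hpolar : ¬ IsPolar K) : IsEquilibriumMeasure K (equilibriumMeasure K) := by
  have hne : K.Nonempty := by
    by_contra hempty
    refine hpolar fun ν _ hν _ hs => ?_
    exact absurd ((Measure.nonempty_support hν).mono hs) hempty
  have h := exists_isEquilibriumMeasure hK hne
  rw [equilibriumMeasure, dif_pos h]
  exact h.choose_spec

lemma IsEquilibriumMeasure.logEnergy_ne_bot {K : Set ℂ} (hpolar : ¬ IsPolar K) {ν : Measure ℂ}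
    (hν : IsEquilibriumMeasure K ν) : logEnergy ν ≠ ⊥ := fun hbot =>
  hpolar <| IsPolar.of_forall_logEnergy fun ν' hν' _ hs =>
    le_bot_iff.1 (hbot ▸ hν.logEnergy_le ν' hν' hs)

/-- `ν` competes on its own support, and every competitor there also competes on `K`. -/
lemma IsEquilibriumMeasure.logCapacity_support {K : Set ℂ} (hK : IsCompact K) {ν : Measure ℂ}
    (hν : IsEquilibriumMeasure K ν) : logCapacity ν.support = EReal.exp (logEnergy ν) := by
  apply le_antisymm
  · exact iSup_le fun ν' => iSup_le fun hν' => iSup_le fun _ => iSup_le fun hs =>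
      EReal.exp_monotone (hν.logEnergy_le ν' hν' (hs.trans hν.support_subset))
  · exact le_iSup_of_le ν <| le_iSup_of_le hν.isProbabilityMeasure <|
      le_iSup_of_le (hK.of_isClosed_subset Measure.isClosed_support hν.support_subset) <|
      le_iSup_of_le subset_rfl le_rfl

end Equilibrium

/-! ### Jensen's inequality and the lower bound for monic polynomials. -/

section LowerBound

open Polynomial

variable {ν : Measure ℂ} [IsProbabilityMeasure ν]

lemma ofReal_exp_integral_le_lintegral {g : ℂ → ℝ} (hg : Integrable g ν) :
    ENNReal.ofReal (Real.exp (∫ z, g z ∂ν)) ≤ ∫⁻ z, ENNReal.ofReal (Real.exp (g z)) ∂ν := by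
  rcases eq_or_ne (∫⁻ z, ENNReal.ofReal (Real.exp (g z)) ∂ν) ∞ with h | h
  · simp [h]
  have hint : Integrable (fun z => Real.exp (g z)) ν :=
    ⟨Real.continuous_exp.comp_aestronglyMeasurable hg.aestronglyMeasurable,
      (hasFiniteIntegral_iff_ofReal (Eventually.of_forall fun z => (Real.exp_pos _).le)).2
        h.lt_top⟩
  rw [← ofReal_integral_eq_lintegral_ofReal hint
    (Eventually.of_forall fun z => (Real.exp_pos _).le)]
  exact ENNReal.ofReal_le_ofReal (convexOn_exp.map_integral_le Real.continuous_exp.continuousOn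
    isClosed_univ (Eventually.of_forall fun _ => Set.mem_univ _) hg hint)

/-- The logarithm of the product is the sum of the `log |a - w|`, each with integral at least `I`.
Nonvanishing is carried through the induction because `Real.log_mul` needs it. -/
lemma integrable_and_le_integral_log_norm_prod (hatom : ∀ z, ∀ᵐ w ∂ν, w ≠ z) {I : ℝ}
    (hI : ∀ z, Integrable (fun w => Real.log ‖z - w‖) ν ∧ I ≤ logPotential ν z)
    (s : Multiset ℂ) :
    (∀ᵐ w ∂ν, (s.map fun a => w - a).prod ≠ 0) ∧
      Integrable (fun w => Real.log ‖(s.map fun a => w - a).prod‖) ν ∧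
      s.card * I ≤ ∫ w, Real.log ‖(s.map fun a => w - a).prod‖ ∂ν := by
  induction s using Multiset.induction with
  | empty => simp
  | cons a s ih =>
    obtain ⟨h1, h2, h3⟩ := ih
    obtain ⟨h4, h5⟩ := hI a
    have hne : ∀ᵐ w ∂ν, ((a ::ₘ s).map fun a => w - a).prod ≠ 0 := by
      filter_upwards [h1, hatom a] with w hw hwa
      rw [Multiset.map_cons, Multiset.prod_cons]
      exact mul_ne_zero (sub_ne_zero.2 hwa) hw
    have heq : ∀ᵐ w ∂ν, Real.log ‖a - w‖ + Real.log ‖(s.map fun a => w - a).prod‖ =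
        Real.log ‖((a ::ₘ s).map fun a => w - a).prod‖ := by
      filter_upwards [h1, hatom a] with w hw hwa
      rw [Multiset.map_cons, Multiset.prod_cons, norm_mul, norm_sub_rev a w,
        Real.log_mul (norm_ne_zero_iff.2 (sub_ne_zero.2 hwa)) (norm_ne_zero_iff.2 hw)]
    refine ⟨hne, (h4.add h2).congr heq, ?_⟩
    rw [← integral_congr_ae heq, integral_add h4 h2, ← logPotential, Multiset.card_cons]
    push_cast
    linarith

/-- Jensen's inequality for `|P|² h`, given a lower bound for the potential. -/
lemma ofReal_exp_le_lintegral_sq_mul (hatom : ∀ z, ∀ᵐ w ∂ν, w ≠ z) {I : ℝ}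
    (hI : ∀ z, Integrable (fun w => Real.log ‖z - w‖) ν ∧ I ≤ logPotential ν z)
    {h : ℂ → ℝ≥0} (hpos : ∀ᵐ z ∂ν, h z ≠ 0) (hlog : Integrable (fun z => Real.log (h z)) ν)
    {P : ℂ[X]} (hP : P.Monic) :
    ENNReal.ofReal (Real.exp (∫ z, Real.log (h z) ∂ν)) *
        (ENNReal.ofReal (Real.exp I) ^ P.natDegree) ^ 2 ≤
      ∫⁻ z, (h z : ℝ≥0∞) * ‖P.eval z‖ₑ ^ 2 ∂ν := by
  have hsplit := IsAlgClosed.splits P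
  obtain ⟨h1, h2, h3⟩ := integrable_and_le_integral_log_norm_prod hatom hI P.roots
  simp only [← hsplit.eval_eq_prod_roots_of_monic hP] at h1 h2 h3
  rw [← hsplit.natDegree_eq_card_roots] at h3
  have hint : Integrable (fun z => Real.log (h z) + 2 * Real.log ‖P.eval z‖) ν :=
    hlog.add (h2.const_mul 2)
  calc _ = ENNReal.ofReal (Real.exp (∫ z, Real.log (h z) ∂ν + 2 * (P.natDegree * I))) := by
        rw [← ENNReal.ofReal_pow (Real.exp_pos _).le, ← ENNReal.ofReal_pow (by positivity),
          ← ENNReal.ofReal_mul (Real.exp_pos _).le, ← Real.exp_nat_mul, ← Real.exp_nat_mul,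
          ← Real.exp_add]
        norm_num
    _ ≤ ENNReal.ofReal (Real.exp (∫ z, (Real.log (h z) + 2 * Real.log ‖P.eval z‖) ∂ν)) := by
        rw [integral_add hlog (h2.const_mul 2), integral_const_mul]
        gcongr
    _ ≤ ∫⁻ z, ENNReal.ofReal (Real.exp (Real.log (h z) + 2 * Real.log ‖P.eval z‖)) ∂ν :=
        ofReal_exp_integral_le_lintegral hint
    _ = _ := by
        refine lintegral_congr_ae ?_
        filter_upwards [hpos, h1] with z hz hPz
        have hz' : (0 : ℝ) < h z := NNReal.coe_pos.2 (pos_iff_ne_zero.2 hz)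
        rw [Real.exp_add, Real.exp_log hz', two_mul, Real.exp_add,
          Real.exp_log (norm_pos_iff.2 hPz), ENNReal.ofReal_mul hz'.le,
          ENNReal.ofReal_mul (norm_nonneg _), ofReal_norm, ENNReal.ofReal_coe_nnreal, sq]

end LowerBound

end LogPotential

end

theorem theorem1p3
    (K : Set ℂ) (hK : IsCompact K) (hKpolar : ¬ LogPotential.IsPolar K)
    (μ : Measure ℂ) [IsProbabilityMeasure μ]
    (L : Set ℂ) (hL : IsCompact L) (hKL : LogPotential.outerBoundary K ⊆ L)
    (hμL : μ.support ⊆ L)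
    (μs : Measure ℂ) (hμs : μs ⟂ₘ LogPotential.equilibriumMeasure K)
    (h : ℂ → ℝ≥0) (hh : AEMeasurable h (LogPotential.equilibriumMeasure K))
    (hμ : μ = (LogPotential.equilibriumMeasure K).withDensity (fun z => (h z : ℝ≥0∞)) + μs)
    (hM : ⊥ < LogPotential.szegoIntegral K h)
    (hcap : LogPotential.logCapacity μ.support =
      LogPotential.logCapacity (LogPotential.equilibriumMeasure K).support) :
    EReal.exp (LogPotential.szegoIntegral K h) ≤ ⨅ n : ℕ, LogPotential.widomFactor μ n ^ 2 := by
  open LogPotential in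
  have hν := isEquilibriumMeasure_equilibriumMeasure hK hKpolar
  rw [szegoIntegral] at hM ⊢
  set ν := equilibriumMeasure K with hνdef
  have hprob := hν.isProbabilityMeasure
  have hνK : ∀ᵐ z ∂ν, z ∈ K :=
    Filter.mem_of_superset Measure.support_mem_ae hν.support_subset
  have hμL' : ∀ᵐ z ∂μ, z ∈ L := Filter.mem_of_superset Measure.support_mem_ae hμL
  obtain ⟨hint, hdiag⟩ := integrable_log_of_logEnergy_ne_bot hK hνK (hν.logEnergy_ne_bot hKpolar)
  -- Discarding the singular part only lowers the norm; it also shows that `h` has finite integral,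
  -- so `log h` is integrable.
  have hac : ν.withDensity (fun z => (h z : ℝ≥0∞)) ≤ μ := by
    rw [hμ]; exact Measure.le_add_right le_rfl
  have hfin : ∫⁻ z, (h z : ℝ≥0∞) ∂ν ≠ ∞ := by
    have := hac Set.univ
    rw [withDensity_apply _ MeasurableSet.univ, Measure.restrict_univ] at this
    exact (this.trans_lt (measure_lt_top μ _)).ne
  obtain ⟨hpos, hlog, hMeq⟩ :=
    integrable_log_of_extIntegral_ne_bot hh.coe_nnreal_ennreal hfin hM.ne'
  simp only [ENNReal.coe_toReal] at hlog hMeq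
  refine le_iInf fun n => ?_
  have hP := isMonicMinimizer_monicOrthogonalPolynomial hL hμL' n
  rw [widomFactor, hcap, hν.logCapacity_support hK, logEnergy_eq_integral hint hdiag, hMeq,
    EReal.exp_coe, EReal.exp_coe]
  set P := monicOrthogonalPolynomial μ n
  set I := ∫ p, Real.log ‖p.1 - p.2‖ ∂(ν.prod ν)
  have hc0 : ENNReal.ofReal (Real.exp I) ≠ 0 := by simp [Real.exp_pos]
  have key := ofReal_exp_le_lintegral_sq_mul (ae_ne_of_ae_prod_ne hdiag)
    (hν.integrable_and_le_logPotential hK hint hdiag)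
    (hpos.mono fun z hz => by simpa using hz.1) hlog hP.monic
  rw [hP.natDegree_eq] at key
  -- Clearing the denominator is legitimate because the capacity `exp I` is neither `0` nor `∞`.
  rw [div_eq_mul_inv, mul_pow, ← ENNReal.inv_pow, ← div_eq_mul_inv,
    ENNReal.le_div_iff_mul_le (Or.inl (pow_ne_zero _ (pow_ne_zero _ hc0)))
    (Or.inl (ENNReal.pow_ne_top (ENNReal.pow_ne_top ENNReal.ofReal_ne_top)))]
  refine key.trans ?_
  rw [polyNorm_sq]
  calc ∫⁻ z, (h z : ℝ≥0∞) * ‖P.eval z‖ₑ ^ 2 ∂ν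
      = ∫⁻ z, ‖P.eval z‖ₑ ^ 2 ∂(ν.withDensity fun z => (h z : ℝ≥0∞)) :=
        (lintegral_withDensity_eq_lintegral_mul₀ hh.coe_nnreal_ennreal
          (P.continuous.measurable.enorm.pow_const 2).aemeasurable).symm
    _ ≤ ∫⁻ z, ‖P.eval z‖ₑ ^ 2 ∂μ := lintegral_mono' hac le_rfl
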